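/- **Theorem 2.1** (Hulanicki's lemma for $p$-Banach algebras). Let $0<p\le 1$. Let $\mathcal A$ be a $p$-Banach $\ast$-algebra, that is, a complex associative algebra, not necessarily unital, with a map $\|\cdot\|:\mathcal A\to[0,\infty)$ such that $\|x\|=0$ if and only if $x=0$, $\|x+y\|\le\|x\|+\|y\|$, $\|\alpha x\|=|\alpha|^p\|x\|$ and $\|xy\|\le\|x\|\,\|y\|$ for all $x,y\in\mathcal A$ and $\alpha\in\mathbb C$, complete for the metric $\|x-y\|$, and with an isometric (conjugate-linear, anti-multiplicative) involution $\ast$. Let $S$ be a $\ast$-subalgebra of $\mathcal A$, not necessarily closed, and let $T:\mathcal A\to B(\mathcal H)$, $x\mapsto T_x$, be a faithful (that is, injective) $\ast$-representation on a complex Hilbert space $\mathcal H$ such that $$\|T_x\|_{op}^p=\lim_{n\to\infty}\|x^n\|^{1/n}\qquad\text{for all } x=x^\ast\in S.$$ If $\mathcal A$ has a unit $e$, assume in addition that $T_e=I$, the identity operator on $\mathcal H$. Then $$\sigma_{\mathcal A}(x)=\sigma(T_x)\qquad\text{for all } x=x^\ast\in S.$$ Here $\sigma(T_x)$ is the spectrum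 of $T_x$ in $B(\mathcal H)$. If $\mathcal A$ has a unit $e$, then $\sigma_{\mathcal A}(x)=\{\lambda\in\mathbb C:\lambda e-x\text{ is not invertible in }\mathcal A\}$; if $\mathcal A$ has no unit, then $\sigma_{\mathcal A}(x)$ is the spectrum of $x$ in the unitization $\mathcal A\oplus\mathbb C$. -/

import Mathlib

open Filter Topology

/-- The `p`-homogeneity `‖α x‖ = |α| ^ p ‖x‖` of a `p`-norm.  The other axioms of a `p`-norm
(`‖x‖ = 0 ↔ x = 0`, the triangle inequality and submultiplicativity) are those of Mathlib's
`NonUnitalNormedRing`, which demands no homogeneity of the norm. -/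
def IsPHomogeneous (p : ℝ) (A : Type*) [NonUnitalNormedRing A] [Module ℂ A] : Prop :=
  ∀ (α : ℂ) (x : A), ‖α • x‖ = ‖α‖ ^ p * ‖x‖

/-- `e` is a (two-sided) unit of the possibly non-unital algebra `A`. -/
def IsAlgUnit {A : Type*} [Mul A] (e : A) : Prop :=
  ∀ a : A, e * a = a ∧ a * e = a

/-- The spectrum of `x` in a complex algebra `A`.  If `A` has a unit `e`, it consists of
the `z` for which `z e - x` is not invertible in `A`; if `A` has no unit, it is the spectrum of
`x` in the unitization of `A`. -/
def algSpectrum {A : Type*} [NonUnitalRing A] [Module ℂ A] [IsScalarTower ℂ A A]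
    [SMulCommClass ℂ A A] (x : A) : Set ℂ :=
  {z : ℂ |
    (∃ e : A, IsAlgUnit e ∧ ¬ ∃ y : A, (z • e - x) * y = e ∧ y * (z • e - x) = e) ∨
    ((¬ ∃ e : A, IsAlgUnit e) ∧ z ∈ spectrum ℂ (x : Unitization ℂ A))}

/-- For `x` in a possibly non-unital algebra, `mulPow x n` is the power `x ^ (n + 1)`. -/
def mulPow {A : Type*} [Mul A] (x : A) : ℕ → A
  | 0 => x
  | n + 1 => mulPow x n * x

/-! A unital homomorphism can only shrink spectra, so `T` gives one inclusion; `hunit` makes it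
unital when `A` has a unit, and the unitization does so otherwise. Conversely, suppose `z - T x` is
invertible. If `z ≠ 0`, a polynomial `U` with `U(0) = 0`, `U(z) = 1` and `‖U(T x)‖ < 1` gives a
self-adjoint `y = U(x)` in `S`. The spectral radius hypothesis and a Neumann series make `1 - y`
invertible, so `1 ∉ σ(U(x))` and spectral mapping excludes `z` from the spectrum of `x`. If `z = 0`,
a unit must be found inside `A`. Some `y ∈ S` has `T y = 1 - D` with `D` small. The Catalan series
in `v = y - y * y` converges in `A` to a root `s` of `s = v + s * s`; smallness forces `T s = D`, so
`T (y + s) = 1`. By injectivity `y + s` is a unit, and it is a left multiple of `x`. -/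

section Algebra

variable {A : Type*} [NonUnitalRing A]

theorem mulPow_mul_mulPow (x : A) (m n : ℕ) :
    mulPow x m * mulPow x n = mulPow x (m + n + 1) := by
  induction n with
  | zero => rfl
  | succ n ih => rw [mulPow, ← mul_assoc, ih]; rfl

theorem mulPow_succ_left (x : A) (n : ℕ) : mulPow x (n + 1) = x * mulPow x n := by
  have h := mulPow_mul_mulPow x 0 n
  rw [zero_add] at h
  exact h.symm

theorem map_mulPow {R F : Type*} [Ring R] [FunLike F A R] [MulHomClass F A R] (f : F) (x : A)
    (n : ℕ) : f (mulPow x n) = f x ^ (n + 1) := by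
  induction n with
  | zero => simp [mulPow]
  | succ n ih => rw [mulPow, map_mul, ih, pow_succ _ (n + 1)]

end Algebra

theorem catalan_le_four_pow (n : ℕ) : catalan n ≤ 4 ^ n := by
  rw [catalan_eq_centralBinom_div]
  refine (Nat.div_le_self _ _).trans ?_
  rw [Nat.centralBinom]
  refine (Nat.choose_le_two_pow _ _).trans_eq ?_
  rw [pow_mul]; norm_num

theorem norm_mulPow_le {A : Type*} [NonUnitalNormedRing A] (x : A) (n : ℕ) :
    ‖mulPow x n‖ ≤ ‖x‖ ^ (n + 1) := by
  induction n with
  | zero => simp [mulPow]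
  | succ n ih =>
    rw [mulPow, pow_succ]
    exact (norm_mul_le _ _).trans (by gcongr)

/-! ### Neumann series in the unitization -/

section Neumann

variable {A : Type*} [NonUnitalNormedRing A] [CompleteSpace A] [Module ℂ A]
  [IsScalarTower ℂ A A] [SMulCommClass ℂ A A]

theorem isUnit_one_sub_inr_of_summable {y : A} (hy : Summable fun n => ‖mulPow y n‖) :
    IsUnit (1 - (y : Unitization ℂ A)) := by
  have hs : Summable (mulPow y) := hy.of_norm
  set w := ∑' n, mulPow y n with hw
  have h0 : w = y + ∑' n, mulPow y (n + 1) := hs.tsum_eq_zero_add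
  have h1 : w = y + w * y := by
    rw [← hs.tsum_mul_right]; exact h0
  have h2 : w = y + y * w := by
    conv_lhs => rw [h0]
    simp only [mulPow_succ_left]
    rw [hs.tsum_mul_left]
  have e1 : (w : Unitization ℂ A) = y + w * y := by
    rw [← Unitization.inr_mul, ← Unitization.inr_add, ← h1]
  have e2 : (w : Unitization ℂ A) = y + y * w := by
    rw [← Unitization.inr_mul, ← Unitization.inr_add, ← h2]
  refine ⟨⟨1 - y, 1 + w, ?_, ?_⟩, rfl⟩
  · calc (1 - (y : Unitization ℂ A)) * (1 + w) = 1 + w - (y + y * w) := by noncomm_ring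
      _ = 1 := by rw [← e2]; abel
  · calc (1 + (w : Unitization ℂ A)) * (1 - y) = 1 + w - (y + w * y) := by noncomm_ring
      _ = 1 := by rw [← e1]; abel

theorem isUnit_one_sub_inr_of_norm_lt_one {y : A} (hy : ‖y‖ < 1) :
    IsUnit (1 - (y : Unitization ℂ A)) := by
  refine isUnit_one_sub_inr_of_summable
    (Summable.of_nonneg_of_le (fun _ => norm_nonneg _) (norm_mulPow_le y) ?_)
  exact (summable_geometric_of_lt_one (norm_nonneg y) hy).comp_injective
    (add_left_injective 1)

end Neumann

/-! ### Spectral radius and convergence of power series -/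

section Growth

variable {A : Type*} [NonUnitalNormedRing A]

theorem eventually_norm_mulPow_le {x : A} {l ρ : ℝ}
    (h : Tendsto (fun n : ℕ => ‖mulPow x n‖ ^ (1 / ((n : ℝ) + 1))) atTop (𝓝 l)) (hl : l < ρ) :
    ∀ᶠ n in atTop, ‖mulPow x n‖ ≤ ρ ^ (n + 1) := by
  filter_upwards [h.eventually (gt_mem_nhds hl)] with n hn
  have hn0 : ((n : ℝ) + 1) ≠ 0 := by positivity
  have := pow_le_pow_left₀ (by positivity) hn.le (n + 1)
  rwa [← Real.rpow_natCast, ← Real.rpow_mul (norm_nonneg _), Nat.cast_add, Nat.cast_one,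
    one_div_mul_cancel hn0, Real.rpow_one] at this

theorem summable_norm_mulPow {x : A} {l : ℝ}
    (h : Tendsto (fun n : ℕ => ‖mulPow x n‖ ^ (1 / ((n : ℝ) + 1))) atTop (𝓝 l)) (hl : l < 1) :
    Summable fun n => ‖mulPow x n‖ := by
  have hl0 : 0 ≤ l := ge_of_tendsto' h fun n => by positivity
  obtain ⟨ρ, h1, h2⟩ := exists_between hl
  refine Summable.of_norm_bounded_eventually_nat
    ((summable_geometric_of_lt_one (hl0.trans h1.le) h2).comp_injective (add_left_injective 1)) ?_
  filter_upwards [eventually_norm_mulPow_le h h1] with n hn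
  simpa using hn

/-- Coefficients growing at most like `4 ^ n` are summable against powers of an element of
spectral radius below `8 ^ (-p)`. -/
theorem summable_norm_smul_mulPow [Module ℂ A] {p : ℝ} (hp0 : 0 < p) (hnorm : IsPHomogeneous p A)
    {x : A} {l : ℝ}
    (h : Tendsto (fun n : ℕ => ‖mulPow x n‖ ^ (1 / ((n : ℝ) + 1))) atTop (𝓝 l))
    (hl : l < (1 / 8 : ℝ) ^ p) {c : ℕ → ℕ} (hc : ∀ n, c n ≤ 4 ^ (n + 1)) :
    Summable fun n => ‖(c n : ℂ) • mulPow x n‖ := by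
  have hh : (1 / 2 : ℝ) ^ p < 1 := Real.rpow_lt_one (by norm_num) (by norm_num) hp0
  refine Summable.of_norm_bounded_eventually_nat
    ((summable_geometric_of_lt_one (by positivity) hh).comp_injective (add_left_injective 1)) ?_
  filter_upwards [eventually_norm_mulPow_le h hl] with n hn
  have hcn : (c n : ℝ) ≤ (4 : ℝ) ^ (n + 1) := mod_cast hc n
  rw [norm_norm, hnorm, Complex.norm_natCast]
  calc (c n : ℝ) ^ p * ‖mulPow x n‖ ≤ ((4 : ℝ) ^ (n + 1)) ^ p * ((1 / 8 : ℝ) ^ p) ^ (n + 1) := by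
        gcongr
    _ = ((1 / 2 : ℝ) ^ p) ^ (n + 1) := by
        rw [← Real.rpow_natCast, ← Real.rpow_mul (by norm_num), mul_comm _ p,
          Real.rpow_mul (by norm_num), Real.rpow_natCast, ← mul_pow,
          ← Real.mul_rpow (by norm_num) (by norm_num)]
        norm_num

/-- The Catalan generating function solves `s = v + s * s`. -/
theorem exists_eq_add_mul_self [CompleteSpace A] [Module ℂ A] [IsScalarTower ℂ A A]
    [SMulCommClass ℂ A A] {v : A}
    (hv : ∀ c : ℕ → ℕ, (∀ n, c n ≤ 4 ^ (n + 1)) → Summable fun n => ‖(c n : ℂ) • mulPow v n‖) :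
    ∃ s w : A, HasSum (fun n => (catalan n : ℂ) • mulPow v n) s ∧ s = v + s * s ∧
      s = v + w * v := by
  have h1 := hv catalan fun n =>
    (catalan_le_four_pow n).trans (Nat.pow_le_pow_right (by norm_num) n.le_succ)
  have h2 := hv (fun n => catalan (n + 1)) fun n => catalan_le_four_pow _
  set f : ℕ → A := fun n => (catalan n : ℂ) • mulPow v n with hf
  have hs : Summable f := h1.of_norm
  have h0 : ∑' n, f n = v + ∑' n, f (n + 1) := by
    rw [hs.tsum_eq_zero_add]; simp [hf, mulPow]
  have hprod : Summable fun x : ℕ × ℕ => f x.1 * f x.2 := by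
    refine Summable.of_norm_bounded (h1.mul_of_nonneg h1 (fun _ => norm_nonneg _)
      (fun _ => norm_nonneg _)) fun x => norm_mul_le _ _
  -- Every term after the first has a right factor `v`, whence `w`. The Catalan recursion is the
  -- Cauchy product.
  refine ⟨∑' n, f n, ∑' n, (catalan (n + 1) : ℂ) • mulPow v n, hs.hasSum, ?_, ?_⟩
  · conv_lhs => rw [h0]
    rw [hs.tsum_mul_tsum_eq_tsum_sum_antidiagonal hs hprod]
    congr 2
    ext n
    have : ∀ ij ∈ Finset.HasAntidiagonal.antidiagonal n,
        f ij.1 * f ij.2 = ((catalan ij.1 * catalan ij.2 : ℕ) : ℂ) • mulPow v (n + 1) := by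
      intro ij hij
      rw [Finset.HasAntidiagonal.mem_antidiagonal] at hij
      rw [hf, smul_mul_smul_comm, mulPow_mul_mulPow, hij, Nat.cast_mul]
    rw [Finset.sum_congr rfl this, ← Finset.sum_smul, ← Nat.cast_sum, ← catalan_succ']
  · rw [h0, ← h2.of_norm.tsum_mul_right]
    simp [hf, mulPow, smul_mul_assoc]

end Growth

/-- If `Q` is invertible in a C⋆-algebra, a suitable multiple of `Q⋆ Q` is at distance less than
one from the identity. -/
theorem exists_norm_one_sub_smul_star_mul_self_lt_one {B : Type*} [CStarAlgebra B] {Q : B}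
    (hQ : IsUnit Q) : ∃ c : ℝ, ‖1 - (c : ℂ) • (star Q * Q)‖ < 1 := by
  rcases subsingleton_or_nontrivial B with hB | hB
  · exact ⟨0, by rw [Subsingleton.elim (1 - _) (0 : B), norm_zero]; exact one_pos⟩
  set P := star Q * Q with hP
  have hPu : IsUnit P := hQ.star.mul hQ
  have hPs : IsSelfAdjoint P := IsSelfAdjoint.star_mul_self Q
  have hP0 : 0 < ‖P‖ := norm_pos_iff.2 hPu.ne_zero
  -- The spectrum of `P` lies in `(0, ‖P‖]`, so that of `1 - P / ‖P‖` lies in `[0, 1)`; for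
  -- self-adjoint elements the norm is the spectral radius.
  refine ⟨‖P‖⁻¹, ?_⟩
  have hsa : IsSelfAdjoint (1 - ((‖P‖⁻¹ : ℝ) : ℂ) • P) :=
    (IsSelfAdjoint.one B).sub (IsSelfAdjoint.smul (Complex.conj_ofReal _) hPs)
  have key : spectralRadius ℂ (1 - ((‖P‖⁻¹ : ℝ) : ℂ) • P) < ((1 : NNReal) : ENNReal) := by
    refine spectrum.spectralRadius_lt_of_forall_lt _ fun z hz => ?_
    have hU : 1 - ((‖P‖⁻¹ : ℝ) : ℂ) • P = Polynomial.aeval P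
        (1 - Polynomial.C ((‖P‖⁻¹ : ℝ) : ℂ) * Polynomial.X) := by
      simp [Algebra.smul_def]
    rw [hU, spectrum.map_polynomial_aeval_of_nonempty _ _ (spectrum.nonempty P)] at hz
    obtain ⟨w, hw, rfl⟩ := hz
    have hw0 : w ≠ 0 := fun h => spectrum.zero_notMem ℂ hPu (h ▸ hw)
    have hwre : w = (w.re : ℂ) := hPs.mem_spectrum_eq_re hw
    have hwr : w.re ∈ spectrum ℝ P := by
      rw [← spectrum.algebraMap_mem_iff ℂ]
      exact hwre ▸ hw
    have hnn : 0 ≤ w.re := spectrum_star_mul_self_nonneg _ hwr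
    have hpos : 0 < w.re := lt_of_le_of_ne hnn fun h => hw0 (by rw [hwre, ← h]; simp)
    have hle : w.re ≤ ‖P‖ := (Complex.re_le_norm w).trans (spectrum.norm_le_norm_of_mem hw)
    rw [← NNReal.coe_lt_coe, coe_nnnorm, NNReal.coe_one, hwre]
    have : Polynomial.eval (w.re : ℂ) (1 - Polynomial.C ((‖P‖⁻¹ : ℝ) : ℂ) * Polynomial.X) =
        ((1 - ‖P‖⁻¹ * w.re : ℝ) : ℂ) := by simp
    beta_reduce
    rw [this, Complex.norm_real, Real.norm_eq_abs, abs_lt]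
    have h1 : 0 < ‖P‖⁻¹ * w.re := by positivity
    have h2 : ‖P‖⁻¹ * w.re ≤ 1 := by
      rw [inv_mul_le_iff₀ hP0]; linarith
    constructor <;> linarith
  rw [hsa.spectralRadius_eq_nnnorm] at key
  exact_mod_cast key

theorem starLift_inr {A B : Type*} [NonUnitalRing A] [Module ℂ A] [IsScalarTower ℂ A A]
    [SMulCommClass ℂ A A] [StarRing A] [Ring B] [Algebra ℂ B] [StarRing B] [StarModule ℂ B]
    (T : A →⋆ₙₐ[ℂ] B) (a : A) : Unitization.starLift T (a : Unitization ℂ A) = T a := by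
  change algebraMap ℂ B 0 + T a = T a
  rw [map_zero, zero_add]

/-! ### Automatic continuity of the representation -/

section Representation

variable {A : Type*} [NonUnitalNormedRing A] [Module ℂ A] [IsScalarTower ℂ A A]
  [SMulCommClass ℂ A A] [StarRing A]
  {B : Type*} [CStarAlgebra B] (T : A →⋆ₙₐ[ℂ] B)

/-- If `‖b‖ < |z| ^ p`, then `z⁻¹ • b` has norm below one and the Neumann series excludes `z` from
the spectrum of `T b`. -/
theorem norm_rpow_le_of_isSelfAdjoint [CompleteSpace A] {p : ℝ} (hp0 : 0 < p)
    (hnorm : IsPHomogeneous p A) {b : A} (hb : IsSelfAdjoint b) : ‖T b‖ ^ p ≤ ‖b‖ := by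
  have hle : ‖T b‖ ≤ ‖b‖ ^ p⁻¹ := by
    have hsa : IsSelfAdjoint (T b) := hb.map T
    have : spectralRadius ℂ (T b) ≤ ((‖b‖₊ ^ p⁻¹ : NNReal) : ENNReal) := by
      refine iSup₂_le fun z hz => ?_
      rw [ENNReal.coe_le_coe, ← NNReal.coe_le_coe, coe_nnnorm, NNReal.coe_rpow, coe_nnnorm]
      by_contra! hlt
      have hz0 : z ≠ 0 := norm_pos_iff.1 (lt_of_le_of_lt (by positivity) hlt)
      have hz1 : ‖b‖ < ‖z‖ ^ p := by
        rwa [Real.rpow_inv_lt_iff_of_pos (norm_nonneg _) (norm_nonneg _) hp0] at hlt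
      have hy : ‖z⁻¹ • b‖ < 1 := by
        rw [hnorm, norm_inv, Real.inv_rpow (norm_nonneg _),
          inv_mul_lt_iff₀ (Real.rpow_pos_of_pos (norm_pos_iff.2 hz0) _)]
        simpa using hz1
      have hu := (isUnit_one_sub_inr_of_norm_lt_one hy).map (Unitization.starLift T)
      rw [map_sub, map_one, starLift_inr, map_smul] at hu
      refine hz ?_
      have : algebraMap ℂ B z - T b = algebraMap ℂ B z * (1 - z⁻¹ • T b) := by
        rw [mul_sub, mul_one, ← Algebra.smul_def, smul_inv_smul₀ hz0]
      rw [spectrum.mem_resolventSet_iff, this]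
      exact ((IsUnit.mk0 z hz0).map (algebraMap ℂ B)).mul hu
    rw [hsa.spectralRadius_eq_nnnorm] at this
    simpa only [NNReal.coe_rpow, coe_nnnorm] using NNReal.coe_le_coe.2 (ENNReal.coe_le_coe.1 this)
  rwa [Real.le_rpow_inv_iff_of_pos (norm_nonneg _) (norm_nonneg _) hp0] at hle

theorem norm_rpow_map_le [CompleteSpace A] {p : ℝ} (hp0 : 0 < p) (hnorm : IsPHomogeneous p A)
    (hstar : ∀ a : A, ‖star a‖ = ‖a‖) (a : A) : ‖T a‖ ^ p ≤ ‖a‖ := by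
  have h := norm_rpow_le_of_isSelfAdjoint T hp0 hnorm (IsSelfAdjoint.star_mul_self a)
  rw [map_mul, map_star, CStarRing.norm_star_mul_self,
    Real.mul_rpow (norm_nonneg _) (norm_nonneg _)] at h
  refine abs_le_of_sq_le_sq' ?_ (norm_nonneg a) |>.2
  have := norm_mul_le (star a) a
  rw [hstar] at this
  nlinarith

theorem continuous_of_isPHomogeneous [CompleteSpace A] {p : ℝ} (hp0 : 0 < p)
    (hnorm : IsPHomogeneous p A) (hstar : ∀ a : A, ‖star a‖ = ‖a‖) : Continuous T := by
  refine continuous_of_continuousAt_zero T ?_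
  rw [ContinuousAt, map_zero]
  have h0 : Tendsto (fun a : A => ‖a‖ ^ p⁻¹) (𝓝 0) (𝓝 0) := by
    have : Tendsto (fun a : A => ‖a‖ ^ p⁻¹) (𝓝 0) (𝓝 (‖(0 : A)‖ ^ p⁻¹)) :=
      (continuous_norm.tendsto 0).rpow_const (Or.inr (inv_nonneg.2 hp0.le))
    rwa [norm_zero, Real.zero_rpow (inv_ne_zero hp0.ne')] at this
  refine squeeze_zero_norm (fun a => ?_) h0
  rw [Real.le_rpow_inv_iff_of_pos (norm_nonneg _) (norm_nonneg _) hp0]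
  exact norm_rpow_map_le T hp0 hnorm hstar a

end Representation

/-- The elements `λ + s` of the unitization with `s` in a given subalgebra. -/
def NonUnitalStarSubalgebra.unitizationSubalgebra {A : Type*} [NonUnitalRing A] [Module ℂ A]
    [IsScalarTower ℂ A A] [SMulCommClass ℂ A A] [StarRing A]
    (S : NonUnitalStarSubalgebra ℂ A) : Subalgebra ℂ (Unitization ℂ A) where
  carrier := {u | u.snd ∈ S}
  mul_mem' {a b} ha hb := by
    simp only [Set.mem_ofPred_eq, Unitization.snd_mul] at *
    exact add_mem (add_mem (SMulMemClass.smul_mem _ hb) (SMulMemClass.smul_mem _ ha))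
      (mul_mem ha hb)
  add_mem' {a b} ha hb := by
    simp only [Set.mem_ofPred_eq, Unitization.snd_add] at *
    exact add_mem ha hb
  algebraMap_mem' r := by
    simp [Unitization.algebraMap_eq_inl]

theorem Unitization.inr_snd_eq_self {R A : Type*} [AddZeroClass R] [AddZeroClass A]
    {u : Unitization R A} (h : u.fst = 0) : ((u.snd : A) : Unitization R A) = u := by
  ext <;> simp [h]

/-! ### Invertibility transferred from `T x` to `x` -/

section Hulanicki

variable {p : ℝ} {A : Type*} [NonUnitalNormedRing A] [CompleteSpace A] [Module ℂ A]
  [IsScalarTower ℂ A A] [SMulCommClass ℂ A A] [StarRing A] [StarModule ℂ A]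
  {S : NonUnitalStarSubalgebra ℂ A} {B : Type*} [CStarAlgebra B] {T : A →⋆ₙₐ[ℂ] B}

theorem notMem_spectrum_inr_of_ne_zero (hp0 : 0 < p)
    (hrad : ∀ x ∈ S, IsSelfAdjoint x →
      Tendsto (fun n : ℕ => ‖mulPow x n‖ ^ (1 / ((n : ℝ) + 1))) atTop (𝓝 (‖T x‖ ^ p)))
    {x : A} (hxS : x ∈ S) (hx : IsSelfAdjoint x) {z : ℂ} (hz0 : z ≠ 0)
    (hz : z ∉ spectrum ℂ (T x)) : z ∉ spectrum ℂ (x : Unitization ℂ A) := by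
  have hQ : IsUnit (algebraMap ℂ B z - T x) := not_not.1 hz
  obtain ⟨c, hc⟩ := exists_norm_one_sub_smul_star_mul_self_lt_one hQ
  set Q := algebraMap ℂ B z - T x with hQdef
  -- Since `h(0) = |z|²`, the factor `1 - k h` vanishes at `0`; this keeps `U(x)` in `S`. The power
  -- `N` absorbs the norm of this factor.
  set k : ℝ := (Complex.normSq z)⁻¹ with hk
  have hsQ : star Q = algebraMap ℂ B (star z) - T x := by
    rw [hQdef, star_sub, ← algebraMap_star_comm, (hx.map T).star_eq]
  set X : Unitization ℂ A := Unitization.inr x with hX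
  have hXs : IsSelfAdjoint X := by
    rw [IsSelfAdjoint, hX, ← Unitization.inr_star, hx.star_eq]
  obtain ⟨N, hN⟩ : ∃ N : ℕ, ‖1 - (c : ℂ) • (star Q * Q)‖ ^ N * ‖1 - (k : ℂ) • (star Q * Q)‖ < 1 := by
    have := (tendsto_pow_atTop_nhds_zero_of_lt_one (norm_nonneg _) hc).mul_const
      ‖1 - (k : ℂ) • (star Q * Q)‖
    rw [zero_mul] at this
    exact (this.eventually (gt_mem_nhds one_pos)).exists
  set h : Polynomial ℂ :=
    (Polynomial.C (star z) - Polynomial.X) * (Polynomial.C z - Polynomial.X) with hh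
  set U : Polynomial ℂ := (1 - Polynomial.C (c : ℂ) * h) ^ N * (1 - Polynomial.C (k : ℂ) * h)
    with hU
  have hUz : U.eval z = 1 := by simp [hU, hh]
  have hU0 : U.eval 0 = 0 := by
    have : (k : ℂ) * (star z * z) = 1 := by
      rw [hk, Complex.star_def, ← Complex.normSq_eq_conj_mul_self, ← Complex.ofReal_mul,
        inv_mul_cancel₀ (Complex.normSq_pos.2 hz0).ne', Complex.ofReal_one]
    have h1 : h.eval 0 = star z * z := by simp [hh]
    simp only [hU, Polynomial.eval_mul, Polynomial.eval_sub, Polynomial.eval_one,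
      Polynomial.eval_C, h1, this, sub_self, mul_zero]
  set u := Polynomial.aeval X U with hu
  have hufst : u.fst = 0 := by
    have : Unitization.fstHom ℂ A u = U.eval 0 := by
      rw [hu, ← Polynomial.aeval_algHom_apply]
      simp [hX, Polynomial.coe_aeval_eq_eval]
    exact this.trans hU0
  have huy := Unitization.inr_snd_eq_self hufst
  set y := u.snd with hy
  have hyS : y ∈ S := by
    have hXm : X ∈ S.unitizationSubalgebra := by
      change X.snd ∈ S
      simpa [hX] using hxS
    have hum : u ∈ S.unitizationSubalgebra := by
      rw [hu, ← Polynomial.coe_aeval_mk_apply (p := U) (h := hXm)]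
      exact SetLike.coe_mem _
    exact hum
  have hPs : IsSelfAdjoint (Polynomial.aeval X h) := by
    have : Polynomial.aeval X h =
        star (algebraMap ℂ _ z - X) * (algebraMap ℂ _ z - X) := by
      rw [star_sub, ← algebraMap_star_comm, hXs.star_eq]
      simp [hh]
    rw [this]
    exact IsSelfAdjoint.star_mul_self _
  have hfac (r : ℝ) : IsSelfAdjoint (Polynomial.aeval X (1 - Polynomial.C (r : ℂ) * h)) := by
    rw [map_sub, map_mul, map_one, Polynomial.aeval_C, ← Algebra.smul_def]
    exact (IsSelfAdjoint.one _).sub (IsSelfAdjoint.smul (Complex.conj_ofReal _) hPs)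
  have hus : IsSelfAdjoint u := by
    rw [hu, hU, map_mul, map_pow]
    refine (IsSelfAdjoint.commute_iff ((hfac c).pow N) (hfac k)).1 ?_
    rw [← map_pow]
    exact (Commute.all _ _).map (Polynomial.aeval X)
  have hys : IsSelfAdjoint y := by
    have := congrArg (fun a : Unitization ℂ A => a.snd) hus.star_eq
    beta_reduce at this
    rwa [Unitization.snd_star] at this
  have hTy : T y = (1 - (c : ℂ) • (star Q * Q)) ^ N * (1 - (k : ℂ) • (star Q * Q)) := by
    have h2 : (Unitization.starLift T : Unitization ℂ A →⋆ₐ[ℂ] B) X = T x := starLift_inr T x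
    rw [← starLift_inr, huy, hu, ← Polynomial.aeval_algHom_apply, h2, hsQ, hQdef]
    simp [hU, hh, Algebra.smul_def]
  have hTy1 : ‖T y‖ < 1 := by
    rw [hTy]
    refine lt_of_le_of_lt (norm_mul_le _ _) (lt_of_le_of_lt ?_ hN)
    gcongr
    rcases subsingleton_or_nontrivial B with hB | hB
    · rw [Subsingleton.elim ((1 - (c : ℂ) • (star Q * Q)) ^ N) 0, norm_zero]; positivity
    · exact norm_pow_le _ _
  have hunit : IsUnit (1 - (y : Unitization ℂ A)) :=
    isUnit_one_sub_inr_of_summable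
      (summable_norm_mulPow (hrad y hyS hys) (Real.rpow_lt_one (norm_nonneg _) hTy1 hp0))
  intro hmem
  have := spectrum.subset_polynomial_aeval X U ⟨z, hmem, rfl⟩
  simp only [hUz] at this
  rw [← hu, ← huy, spectrum.mem_iff, map_one] at this
  exact this hunit

/-- Inverting in the unitization would not show that `A` has a unit, so a preimage of `1` is built
inside `A`. -/
theorem exists_map_eq_one_of_isUnit (hp0 : 0 < p) (hnorm : IsPHomogeneous p A)
    (hstar : ∀ a : A, ‖star a‖ = ‖a‖)
    (hrad : ∀ x ∈ S, IsSelfAdjoint x →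
      Tendsto (fun n : ℕ => ‖mulPow x n‖ ^ (1 / ((n : ℝ) + 1))) atTop (𝓝 (‖T x‖ ^ p)))
    {x : A} (hxS : x ∈ S) (hx : IsSelfAdjoint x) (hT : IsUnit (T x)) :
    ∃ w : A, T (w * x) = 1 := by
  rcases subsingleton_or_nontrivial B with hB | hB
  · exact ⟨0, Subsingleton.elim _ _⟩
  obtain ⟨c, hc⟩ := exists_norm_one_sub_smul_star_mul_self_lt_one hT
  rw [(hx.map T).star_eq] at hc
  -- With `1/16`, `‖T v‖ ≤ 1/16 + 1/256 < 1/15 < 1/8`, as the Catalan series requires.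
  obtain ⟨N, hN⟩ : ∃ N : ℕ, ‖1 - (c : ℂ) • (T x * T x)‖ ^ N < 1 / 16 :=
    exists_pow_lt_of_lt_one (by norm_num) hc
  set X : Unitization ℂ A := Unitization.inr x with hX
  have hXs : IsSelfAdjoint X := by
    rw [IsSelfAdjoint, hX, ← Unitization.inr_star, hx.star_eq]
  set f : Unitization ℂ A := 1 - (c : ℂ) • (X * X) with hf
  have hfs : IsSelfAdjoint f := (IsSelfAdjoint.one _).sub
    (IsSelfAdjoint.smul (Complex.conj_ofReal _) ((IsSelfAdjoint.commute_iff hXs hXs).1 rfl))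
  have hXm : X ∈ S.unitizationSubalgebra := by
    change X.snd ∈ S
    simpa [hX] using hxS
  have hfm : f ∈ S.unitizationSubalgebra :=
    sub_mem (one_mem _) (Subalgebra.smul_mem _ (mul_mem hXm hXm) _)
  have hfst : (1 - f ^ N).fst = 0 := by
    have hf1 : Unitization.fstHom ℂ A f = 1 := by
      rw [hf, map_sub, map_smul, map_mul, map_one]
      simp [hX]
    have : Unitization.fstHom ℂ A (1 - f ^ N) = 0 := by
      rw [map_sub, map_pow, hf1, map_one, one_pow, sub_self]
    exact this
  have hinr := Unitization.inr_snd_eq_self hfst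
  set y := (1 - f ^ N).snd with hy
  have hyS : y ∈ S := sub_mem (one_mem S.unitizationSubalgebra) (pow_mem hfm N)
  have hys : IsSelfAdjoint y := by
    have := congrArg (fun a : Unitization ℂ A => a.snd) ((IsSelfAdjoint.one _).sub (hfs.pow N)).star_eq
    beta_reduce at this
    rwa [Unitization.snd_star] at this
  obtain ⟨m, hm⟩ : ∃ m : A, y = m * x := by
    set M := (∑ i ∈ Finset.range N, f ^ i) * ((c : ℂ) • X) with hM
    have hMX : 1 - f ^ N = M * X := by
      rw [← geom_sum_mul_neg, hM, mul_assoc, smul_mul_assoc, hf, sub_sub_cancel]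
    have hM0 : M.fst = 0 := by simp [hM, hX]
    refine ⟨M.snd, ?_⟩
    have := hinr.trans hMX
    rw [← Unitization.inr_snd_eq_self hM0, hX, ← Unitization.inr_mul] at this
    exact Unitization.inr_injective this
  set D := (1 - (c : ℂ) • (T x * T x)) ^ N with hD
  have hD16 : ‖D‖ ≤ 1 / 16 := (norm_pow_le _ _).trans hN.le
  have hTy : T y = 1 - D := by
    rw [← starLift_inr, hinr, map_sub, map_pow, hf, map_sub, map_smul, map_mul, hX, starLift_inr,
      map_one]
  set v := y - y * y with hv
  have hvS : v ∈ S := sub_mem hyS (mul_mem hyS hyS)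
  have hvs : IsSelfAdjoint v := hys.sub ((IsSelfAdjoint.commute_iff hys hys).1 rfl)
  have hTv : T v = D - D * D := by
    rw [hv, map_sub, map_mul, hTy]; noncomm_ring
  have hTv15 : ‖T v‖ ≤ 1 / 15 := by
    rw [hTv]
    have h1 := norm_sub_le D (D * D)
    have h2 := norm_mul_le D D
    nlinarith [norm_nonneg D]
  obtain ⟨s, w, hs, hsv, hsw⟩ := exists_eq_add_mul_self (v := v) fun a ha =>
    summable_norm_smul_mulPow hp0 hnorm (hrad v hvS hvs)
      (Real.rpow_lt_rpow (norm_nonneg _) (by linarith) hp0) ha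
  have hTs : ‖T s‖ ≤ 1 / 11 := by
    have h1 := hs.map T (continuous_of_isPHomogeneous T hp0 hnorm hstar)
    have h2 : HasSum (fun n : ℕ => (1 / 15 : ℝ) * (4 / 15) ^ n) (1 / 11) := by
      have h := (hasSum_geometric_of_lt_one (r := (4 / 15 : ℝ)) (by norm_num)
        (by norm_num)).mul_left (1 / 15 : ℝ)
      rwa [show (1 / 15 : ℝ) * (1 - 4 / 15)⁻¹ = 1 / 11 by norm_num] at h
    rw [← h1.tsum_eq]
    refine tsum_of_norm_bounded h2 fun n => ?_
    have hcat : (catalan n : ℝ) ≤ 4 ^ n := mod_cast catalan_le_four_pow n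
    rw [Function.comp_apply, map_smul, map_mulPow, norm_smul, Complex.norm_natCast]
    calc (catalan n : ℝ) * ‖T v ^ (n + 1)‖ ≤ 4 ^ n * (1 / 15) ^ (n + 1) := by
          gcongr
          exact (norm_pow_le _ _).trans (by gcongr)
      _ = 1 / 15 * (4 / 15) ^ n := by
          rw [pow_succ, div_pow, div_pow]; ring
  have hDs : D = T s := by
    have h1 : T s = T v + T s * T s := by rw [← map_mul, ← map_add, ← hsv]
    -- Both `D` and `T s` solve `t = T v + t * t`; as `‖D‖ + ‖T s‖ < 1`, they coincide.
    have h2 : D - T s = D * (D - T s) + (D - T s) * T s := by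
      have : D - T s = D * D - T s * T s := by
        rw [hTv] at h1
        nth_rewrite 1 [h1]
        abel
      rw [mul_sub, sub_mul]
      nth_rewrite 1 [this]
      abel
    have h3 : ‖D - T s‖ ≤ ‖D‖ * ‖D - T s‖ + ‖D - T s‖ * ‖T s‖ := by
      conv_lhs => rw [h2]
      exact (norm_add_le _ _).trans (add_le_add (norm_mul_le _ _) (norm_mul_le _ _))
    have h4 : ‖D - T s‖ = 0 := by nlinarith [norm_nonneg (D - T s)]
    exact sub_eq_zero.1 (norm_eq_zero.1 h4)
  -- As `m * x = y` and `(m - y * m) * x = v`, the product with `x` is `y + s`.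
  refine ⟨m + ((m - y * m) + w * (m - y * m)), ?_⟩
  have hvm : (m - y * m) * x = v := by rw [sub_mul, mul_assoc, ← hm]
  rw [add_mul, add_mul, mul_assoc, hvm, ← hm, ← hsw, map_add, hTy, ← hDs, sub_add_cancel]

theorem exists_isAlgUnit_of_isUnit (hp0 : 0 < p) (hnorm : IsPHomogeneous p A)
    (hstar : ∀ a : A, ‖star a‖ = ‖a‖) (hT : Function.Injective T)
    (hrad : ∀ x ∈ S, IsSelfAdjoint x →
      Tendsto (fun n : ℕ => ‖mulPow x n‖ ^ (1 / ((n : ℝ) + 1))) atTop (𝓝 (‖T x‖ ^ p)))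
    {x : A} (hxS : x ∈ S) (hx : IsSelfAdjoint x) (hTx : IsUnit (T x)) :
    ∃ e w : A, IsAlgUnit e ∧ w * x = e ∧ x * w = e := by
  obtain ⟨w, hw⟩ := exists_map_eq_one_of_isUnit hp0 hnorm hstar hrad hxS hx hTx
  refine ⟨w * x, w, fun a => ⟨hT ?_, hT ?_⟩, rfl, hT ?_⟩
  · rw [map_mul, hw, one_mul]
  · rw [map_mul, hw, mul_one]
  · rw [hw, map_mul]
    rw [map_mul] at hw
    obtain ⟨u, hu⟩ := hTx
    rw [← hu] at hw ⊢
    rw [Units.eq_inv_of_mul_eq_one_right hw, Units.mul_inv]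

end Hulanicki

/-- The map `λ + a ↦ λ e + a` is multiplicative and sends `1` to `e`, so it carries inverses to
inverses. -/
theorem exists_inverse_of_notMem_spectrum_inr {A : Type*} [NonUnitalRing A] [Module ℂ A]
    [IsScalarTower ℂ A A] [SMulCommClass ℂ A A] {x e : A} (he : IsAlgUnit e) {z : ℂ}
    (hz : z ∉ spectrum ℂ (x : Unitization ℂ A)) :
    ∃ y : A, (z • e - x) * y = e ∧ y * (z • e - x) = e := by
  let φ : Unitization ℂ A → A := fun u => u.fst • e + u.snd
  have hmul (u v : Unitization ℂ A) : φ (u * v) = φ u * φ v := by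
    simp only [φ, Unitization.fst_mul, Unitization.snd_mul, add_mul, mul_add, smul_mul_assoc,
      mul_smul_comm, (he _).1, (he _).2, smul_add, smul_smul]
    rw [mul_comm v.fst]
    abel
  have hone : φ 1 = e := by simp [φ]
  have hx : φ (algebraMap ℂ (Unitization ℂ A) z - x) = z • e - x := by
    simp [φ, Unitization.algebraMap_eq_inl, sub_eq_add_neg]
  obtain ⟨u, hu⟩ : IsUnit (algebraMap ℂ (Unitization ℂ A) z - x) := not_not.1 hz
  rw [← hx, ← hu]
  exact ⟨φ ↑u⁻¹, by rw [← hmul, Units.mul_inv, hone], by rw [← hmul, Units.inv_mul, hone]⟩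

theorem theorem2p1 {p : ℝ} (hp0 : 0 < p) (hp1 : p ≤ 1)
    {A : Type*} [NonUnitalNormedRing A] [CompleteSpace A] [Module ℂ A] [IsScalarTower ℂ A A]
    [SMulCommClass ℂ A A] [StarRing A] [StarModule ℂ A]
    (hnorm : IsPHomogeneous p A) (hstar : ∀ a : A, ‖star a‖ = ‖a‖)
    (S : NonUnitalStarSubalgebra ℂ A)
    {H : Type*} [NormedAddCommGroup H] [InnerProductSpace ℂ H] [CompleteSpace H]
    (T : A →⋆ₙₐ[ℂ] (H →L[ℂ] H)) (hT : Function.Injective T)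
    (hrad : ∀ x ∈ S, IsSelfAdjoint x →
      Tendsto (fun n : ℕ => ‖mulPow x n‖ ^ (1 / ((n : ℝ) + 1))) atTop (𝓝 (‖T x‖ ^ p)))
    (hunit : ∀ e : A, IsAlgUnit e → T e = 1)
    (x : A) (hxS : x ∈ S) (hx : IsSelfAdjoint x) :
    algSpectrum x = spectrum ℂ (T x) := by
  ext z
  constructor
  · intro hz
    by_contra hzT
    rcases eq_or_ne z 0 with rfl | hz0
    · have hTx : IsUnit (T x) := spectrum.isUnit_of_zero_notMem ℂ hzT
      obtain ⟨e, w, he, hwx, hxw⟩ := exists_isAlgUnit_of_isUnit hp0 hnorm hstar hT hrad hxS hx hTx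
      rcases hz with ⟨e', he', hinv⟩ | ⟨hne, -⟩
      · have hee : e' = e := by rw [← (he e').1, (he' e).2]
        refine hinv ⟨-w, ?_, ?_⟩ <;> simp [hee, hwx, hxw]
      · exact hne ⟨e, he⟩
    · have hz' := notMem_spectrum_inr_of_ne_zero hp0 hrad hxS hx hz0 hzT
      rcases hz with ⟨e, he, hinv⟩ | ⟨-, hmem⟩
      · exact hinv (exists_inverse_of_notMem_spectrum_inr he hz')
      · exact hz' hmem
  · intro hz
    by_cases hA : ∃ e : A, IsAlgUnit e
    · obtain ⟨e, he⟩ := hA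
      refine Or.inl ⟨e, he, fun ⟨y, h1, h2⟩ => hz ?_⟩
      have g1 := congrArg T h1
      have g2 := congrArg T h2
      simp only [map_mul, map_sub, map_smul, hunit e he] at g1 g2
      rw [spectrum.mem_resolventSet_iff, Algebra.algebraMap_eq_smul_one]
      exact ⟨⟨_, T y, g1, g2⟩, rfl⟩
    · refine Or.inr ⟨hA, ?_⟩
      have := AlgHom.spectrum_apply_subset (Unitization.starLift T) (x : Unitization ℂ A)
      refine this ?_
      rwa [starLift_inr]
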